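/- Let $\mathcal{C}=\mathbb{C}[\hbar,\hbar^{-1}]$ and let $\widehat{\mathfrak H}^1$ be the noncommutative polynomial algebra over $\mathcal C$ in the variables $e_1$ and $g_k$ $(k\ge 1)$, with concatenation product. Equivalently, it is freely generated by the alphabet $\mathcal A=\{d\}\sqcup\{g_k\mid k\ge1\}$, where $d=e_1-g_1$. Put $e_k=g_k+\hbar g_{k-1}$ for $k\ge 2$, and let $\mathfrak z$ be the free $\mathcal C$-module spanned by $\mathcal A$. Let $\circ_\hbar:\mathfrak z\times\mathfrak z\to\mathfrak z$ be the symmetric $\mathcal C$-bilinear map with $$d\circ_\hbar d=\hbar d,\qquad d\circ_\hbar g_k=\hbar g_k,\qquad g_k\circ_\hbar g_l=g_{k+l}\qquad(k,l\ge1),$$ and put $u^{\circ_\hbar 1}=u$, $u^{\circ_\hbar n}=u^{\circ_\hbar (n-1)}\circ_\hbar u$ for $n\ge 2$. The harmonic product $*_\hbar$ is the $\mathcal C$-bilinear product on $\widehat{\mathfrak H}^1$ determined by $w*_\hbar 1=1*_\hbar w=w$ and $$(wu)*_\hbar(w'v)=(w*_\hbar w'v)u+(wu*_\hbar w')v+(w*_\hbar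 w')(u\circ_\hbar v)$$ for $w,w'\in\widehat{\mathfrak H}^1$ and $u,v\in\mathcal A$. It is extended to $\widehat{\mathfrak H}^1[[X]]$ coefficientwise, with $X$ central: $\bigl(\sum_k a_kX^k\bigr)*_\hbar\bigl(\sum_l b_lX^l\bigr)=\sum_n\bigl(\sum_{k+l=n}a_k*_\hbar b_l\bigr)X^n$. For $f\in X\widehat{\mathfrak H}^1[[X]]$ put $\exp_{*_\hbar}(f)=1+\sum_{n\ge1}\frac1{n!}f^{*_\hbar n}$. For $k\ge1$ let $$\phi_k=\sum_{j=1}^k (j-1)!\left\{{k\atop j}\right\}\hbar^{k-j}g_j,$$ where $\left\{{k\atop j}\right\}$ are the Stirling numbers of the second kind. Let $$\varphi(\theta;x)=\sum_{k\ge1}\frac{x^k}{k!}\prod_{a=1}^{k-1}(k\theta-a),\qquad \epsilon_n=e^{2\pi i/n}.$$ **Theorem.** For all integers $N\ge2$ and $L\ge1$, the following identity holds in $\widehat{\mathfrak H}^1[[X]]$: $$\frac{1}{1+\hbar^{-NL}e_N^{\circ_\hbar L}X^{NL}}=\exp_{*_\hbar}\left(-\sum_{k\ge2}\frac{\hbar^{-k}}{k!}\phi_k\sum_{m=1}^{NL}\bigl(\varphi(1/N;\epsilon_{NL}^mX)\bigr)^k\right),$$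 where the left-hand side is the inverse with respect to the concatenation product. -/

import Mathlib

namespace QMZV

noncomputable section

/-- The alphabet `𝒜 = {e₁ - g₁} ⊔ {g_k | k ≥ 1}`; the letter `d` stands for `e₁ - g₁`. -/
inductive Letter : Type
  | d : Letter
  | g (k : ℕ+) : Letter

/-- The Laurent polynomial ring `K[ħ, ħ⁻¹]`. -/
abbrev Coeff (K : Type*) [Field K] : Type _ := LaurentPolynomial K

/-- The integer powers `ħ ^ n` of the formal variable `ħ`. -/
def hbarPow (K : Type*) [Field K] (n : ℤ) : Coeff K := LaurentPolynomial.T n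

/-- `𝔷`: the free `K[ħ, ħ⁻¹]`-module with basis the alphabet. -/
abbrev Z (K : Type*) [Field K] : Type _ := Letter →₀ Coeff K

/-- The noncommutative polynomial algebra over `K[ħ, ħ⁻¹]` in the letters of the alphabet
(equivalently, in the variables `e₁ = d + g₁` and `g_k`, `k ≥ 1`); its multiplication is
concatenation of words. -/
abbrev H1 (K : Type*) [Field K] : Type _ := FreeAlgebra (Coeff K) Letter

/-- A letter as an element of `𝔷`. -/
def letterZ (K : Type*) [Field K] (u : Letter) : Z K := Finsupp.single u 1

/-- The inclusion of `𝔷` into the noncommutative polynomial algebra. -/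
def toH1 {K : Type*} [Field K] : Z K →ₗ[Coeff K] H1 K :=
  Finsupp.linearCombination (Coeff K) (FreeAlgebra.ι (Coeff K))

/-- `u ∘ v` for two letters. -/
def circLetter (K : Type*) [Field K] : Letter → Letter → Z K
  | Letter.d, Letter.d => hbarPow K 1 • letterZ K Letter.d
  | Letter.d, Letter.g k => hbarPow K 1 • letterZ K (Letter.g k)
  | Letter.g k, Letter.d => hbarPow K 1 • letterZ K (Letter.g k)
  | Letter.g k, Letter.g l => letterZ K (Letter.g (k + l))

/-- The bilinear map `∘ : 𝔷 × 𝔷 → 𝔷`. -/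
def circ {K : Type*} [Field K] : Z K →ₗ[Coeff K] Z K →ₗ[Coeff K] Z K :=
  Finsupp.linearCombination (Coeff K)
    (fun u => Finsupp.linearCombination (Coeff K) (fun v => circLetter K u v))

/-- The powers `u^{∘ n}` for `n ≥ 1`: `u^{∘ 1} = u`, `u^{∘ (n + 1)} = u^{∘ n} ∘ u`
(`𝔷` has no unit, and the value at `n = 0` is never used). -/
def circPow {K : Type*} [Field K] (u : Z K) : ℕ → Z K
  | 0 => 0
  | 1 => u
  | n + 2 => circ (circPow u (n + 1)) u

/-- The monomial whose letters, read from right to left, form the given list. -/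
def revWord (K : Type*) [Field K] : List Letter → H1 K
  | [] => 1
  | u :: w => revWord K w * FreeAlgebra.ι (Coeff K) u

/-- The harmonic product of two monomials, each given by the list of its letters read from
right to left (so that the head of the list is the last letter of the monomial). -/
def starWord (K : Type*) [Field K] : List Letter → List Letter → H1 K
  | [], w' => revWord K w'
  | u :: w, [] => revWord K (u :: w)
  | u :: w, v :: w' =>
      starWord K w (v :: w') * FreeAlgebra.ι (Coeff K) u
        + starWord K (u :: w) w' * FreeAlgebra.ι (Coeff K) v
        + starWord K w w' * toH1 (circLetter K u v)
  termination_by w w' => w.length + w'.length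

/-- The harmonic product: the bilinear extension of `starWord`. -/
def hstar {K : Type*} [Field K] : H1 K →ₗ[Coeff K] H1 K →ₗ[Coeff K] H1 K :=
  (FreeAlgebra.basisFreeMonoid (Coeff K) Letter).constr (Coeff K) fun w =>
    (FreeAlgebra.basisFreeMonoid (Coeff K) Letter).constr (Coeff K) fun w' =>
      starWord K w.toList.reverse w'.toList.reverse

theorem revWord_append_singleton (K : Type*) [Field K] (l : List Letter) (u : Letter) :
    revWord K (l ++ [u]) = FreeAlgebra.ι (Coeff K) u * revWord K l := by
  induction l with
  | nil => simp [revWord]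
  | cons v l ih => simp [revWord, ih, mul_assoc]

theorem basis_eq_revWord (K : Type*) [Field K] (w : FreeMonoid Letter) :
    FreeAlgebra.basisFreeMonoid (Coeff K) Letter w = revWord K w.toList.reverse := by
  have h : ∀ l : List Letter, FreeAlgebra.basisFreeMonoid (Coeff K) Letter (FreeMonoid.ofList l)
      = revWord K l.reverse := by
    intro l
    induction l with
    | nil =>
      simp [FreeAlgebra.basisFreeMonoid, FreeAlgebra.equivMonoidAlgebraFreeMonoid, revWord]
    | cons u l ih =>
      rw [List.reverse_cons, revWord_append_singleton, ← ih]
      simp [FreeAlgebra.basisFreeMonoid, FreeAlgebra.equivMonoidAlgebraFreeMonoid]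
  exact h w.toList

theorem hstar_revWord (K : Type*) [Field K] (l l' : List Letter) :
    hstar (revWord K l) (revWord K l') = starWord K l l' := by
  have h := basis_eq_revWord K (FreeMonoid.ofList l.reverse)
  have h' := basis_eq_revWord K (FreeMonoid.ofList l'.reverse)
  simp only [FreeMonoid.toList_ofList, List.reverse_reverse] at h h'
  rw [← h, ← h', hstar, Module.Basis.constr_basis, Module.Basis.constr_basis]
  simp

theorem ext_revWord {K : Type*} [Field K] {M : Type*} [AddCommMonoid M] [Module (Coeff K) M]
    {f f' : H1 K →ₗ[Coeff K] M} (h : ∀ l, f (revWord K l) = f' (revWord K l)) : f = f' :=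
  (FreeAlgebra.basisFreeMonoid (Coeff K) Letter).ext fun w => by
    rw [basis_eq_revWord]; exact h _

/-- The first defining property of the harmonic product: `w * 1 = w`. -/
theorem hstar_one {K : Type*} [Field K] (w : H1 K) : hstar w 1 = w := by
  have h : (hstar (K := K)).flip 1 = LinearMap.id := ext_revWord fun l => by
    have := hstar_revWord K l []
    cases l <;> simpa [revWord, starWord] using this
  exact LinearMap.congr_fun h w

/-- The first defining property of the harmonic product: `1 * w = w`. -/
theorem one_hstar {K : Type*} [Field K] (w : H1 K) : hstar 1 w = w := by
  have h : hstar (K := K) 1 = LinearMap.id := ext_revWord fun l => by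
    have := hstar_revWord K [] l
    simpa [revWord, starWord] using this
  exact LinearMap.congr_fun h w

/-- The second defining property of the harmonic product:
`(w u) * (w' v) = (w * w' v) u + (w u * w') v + (w * w') (u ∘ v)`. -/
theorem hstar_mul_letter {K : Type*} [Field K] (w w' : H1 K) (u v : Letter) :
    hstar (w * toH1 (letterZ K u)) (w' * toH1 (letterZ K v)) =
      hstar w (w' * toH1 (letterZ K v)) * toH1 (letterZ K u)
        + hstar (w * toH1 (letterZ K u)) w' * toH1 (letterZ K v)
        + hstar w w' * toH1 (circ (letterZ K u) (letterZ K v)) := by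
  have hu : ∀ u, toH1 (letterZ K u) = FreeAlgebra.ι (Coeff K) u := by
    intro u; simp [toH1, letterZ]
  have hc : circ (letterZ K u) (letterZ K v) = circLetter K u v := by
    simp [circ, letterZ]
  rw [hc, hu, hu]
  let R := fun a : H1 K => LinearMap.mulRight (Coeff K) a
  let a := FreeAlgebra.ι (Coeff K) u
  let b := FreeAlgebra.ι (Coeff K) v
  have h : (hstar (K := K)).compl₁₂ (R a) (R b)
      = ((hstar (K := K)).compl₁₂ LinearMap.id (R b)).compr₂ (R a)
        + ((hstar (K := K)).compl₁₂ (R a) LinearMap.id).compr₂ (R b)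
        + (hstar (K := K)).compr₂ (R (toH1 (circLetter K u v))) := by
    refine ext_revWord fun l => ext_revWord fun l' => ?_
    have h1 := hstar_revWord K (u :: l) (v :: l')
    have h2 := hstar_revWord K l (v :: l')
    have h3 := hstar_revWord K (u :: l) l'
    have h4 := hstar_revWord K l l'
    rw [starWord] at h1
    rw [← h2, ← h3, ← h4] at h1
    simpa [R, a, b, revWord] using h1
  have := LinearMap.congr_fun (LinearMap.congr_fun h w) w'
  simpa [R, a, b] using this

/-- The elements `g_k`, `k ≥ 1`, of `𝔷` (the value at `k = 0` is never used). -/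
def g (K : Type*) [Field K] : ℕ → Z K
  | 0 => 0
  | k + 1 => letterZ K (Letter.g k.succPNat)

/-- The elements `e_k = g_k + ħ g_{k-1}`, `k ≥ 2`, and `e₁ = d + g₁`
(the value at `k = 0` is never used). -/
def e (K : Type*) [Field K] : ℕ → Z K
  | 0 => 0
  | 1 => letterZ K Letter.d + g K 1
  | k + 2 => g K (k + 2) + hbarPow K 1 • g K (k + 1)

/-- `φ_k = ∑_{j=1}^k (j-1)! S(k,j) ħ^{k-j} g_j`, with `S(k,j)` the Stirling numbers of the
second kind. -/
def phi (K : Type*) [Field K] (k : ℕ) : Z K :=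
  ∑ j ∈ Finset.Icc 1 k,
    ((((j - 1).factorial * Nat.stirlingSecond k j : ℕ) : Coeff K) *
      hbarPow K ((k : ℤ) - (j : ℤ))) • g K j

/-- The harmonic product on formal power series in the central variable `X`. -/
def starSeries {K : Type*} [Field K] (f h : PowerSeries (H1 K)) : PowerSeries (H1 K) :=
  PowerSeries.mk fun n => ∑ p ∈ Finset.HasAntidiagonal.antidiagonal n,
    hstar (PowerSeries.coeff p.1 f) (PowerSeries.coeff p.2 h)

/-- Powers of a power series for the harmonic product. -/
def starPow {K : Type*} [Field K] (f : PowerSeries (H1 K)) : ℕ → PowerSeries (H1 K)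
  | 0 => 1
  | n + 1 => starSeries (starPow f n) f

/-- The sum of a family of power series in which only finitely many members contribute to
each coefficient, computed coefficientwise. -/
def formalSum {R : Type*} [Semiring R] {ι : Type*} (F : ι → PowerSeries R) : PowerSeries R :=
  PowerSeries.mk fun n => ∑ᶠ i, PowerSeries.coeff n (F i)

/-- The exponential with respect to the harmonic product, of a power series without constant
term. -/
def expStar {K : Type*} [Field K] (f : PowerSeries (H1 K)) : PowerSeries (H1 K) :=
  formalSum fun n : ℕ => ((n.factorial : K)⁻¹) • starPow f n

/-- The power series `φ(θ; x) = ∑_{k ≥ 1} x^k / k! ∏_{a=1}^{k-1} (k θ - a)`. -/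
def varphi {K : Type*} [Field K] (θ : K) : PowerSeries K :=
  PowerSeries.mk fun k =>
    if k = 0 then 0
    else (k.factorial : K)⁻¹ * ∏ a ∈ Finset.Icc 1 (k - 1), ((k : K) * θ - (a : K))

/-- The product `w · s(X)` of an element `w` and a scalar power series `s(X)`. -/
def mulSeries {K : Type*} [Field K] (w : H1 K) (s : PowerSeries K) : PowerSeries (H1 K) :=
  PowerSeries.C w * PowerSeries.map (algebraMap K (H1 K)) s

/-- `ε_n = exp (2 π i / n)`. -/
def eps (n : ℕ) : ℂ := Complex.exp (2 * Real.pi * Complex.I / n)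

end

end QMZV

/-! Write `z` for ħ^{-NL} e_N^{∘L} and M = NL. The proof has two independent halves.

Noncommutative half: 1/(1 + z X^M) = exp_*(-∑_{q≥1} z^{∘q} X^{Mq}/q). With D = X d/dX, both sides
solve DE = E * Df, where f is the exponent, and both have constant term 1; such a solution is unique
(`eq_of_eulerDeriv_eq_starSeries`). For the exponential this uses only that harmonic multiplications
on the right by elements of 𝔷 commute (`hstar_right_comm`). For the geometric series it is a
telescoping sum (`sum_hstar_pow_circPow`).

Commutative half: the exponent in the theorem equals this f. Sending s^j to ħ^{-j} g_j turns
multiplication of polynomials without constant term into ∘, and z^{∘q} becomes (s^{N-1}(1+s))^{Lq}.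
Summing over roots of unity keeps only the powers X^{Mq}. Formally y = exp φ(θ;x) satisfies y = 1 +
x y^θ, and `rothe` gives the coefficients of y^r, so [x^n] φ^k/k! is the coefficient of r^k in
`rothe θ n`. Summing these against Stirling numbers takes iterated differences in r, which the
functional equation evaluates; at θ = 1/N they become binomial coefficients
(`sum_coeff_rothe_smul_phiPoly`). -/

namespace QMZV

/-! ### Rothe polynomials and the powers of φ(θ; x) -/

open Polynomial in
/-- The polynomial `(r / n!) ∏_{a=1}^{n-1} (r + n θ - a)` in `r`. -/
noncomputable def rothe {K : Type*} [Field K] (θ : K) : ℕ → K[X]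
  | 0 => 1
  | n + 1 => C ((n + 1).factorial : K)⁻¹ *
      (X * ∏ a ∈ Finset.range n, (X + C (((n : K) + 1) * θ - ((a : K) + 1))))

section Rothe

variable {K : Type*} [Field K] (θ : K)

open Polynomial

/-- Coefficientwise form of y^{r+1} - y^r = x y^{r+θ}. The two products on the left share n - 1
linear factors when n ≥ 1, which are exactly those on the right. -/
theorem rothe_eval_succ_sub [CharZero K] (n : ℕ) (r : K) :
    (rothe θ (n + 1)).eval (r + 1) - (rothe θ (n + 1)).eval r = (rothe θ n).eval (r + θ) := by
  cases n with
  | zero => simp [rothe]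
  | succ m =>
    have hm : ((m : K) + 1 + 1) ≠ 0 := by exact_mod_cast (m + 1).succ_ne_zero
    have hf : ((m + 1).factorial : K) ≠ 0 := by exact_mod_cast (m + 1).factorial_ne_zero
    simp only [rothe, eval_mul, eval_C, eval_X, eval_prod, eval_add]
    rw [Finset.prod_range_succ', Finset.prod_range_succ, Nat.factorial_succ (m + 1)]
    have h1 : ∏ k ∈ Finset.range m,
          (r + 1 + (((m + 1 : ℕ) + 1 : K) * θ - (((k + 1 : ℕ) : K) + 1)))
        = ∏ k ∈ Finset.range m, (r + θ + (((m : K) + 1) * θ - ((k : K) + 1))) :=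
      Finset.prod_congr rfl fun k _ => by push_cast; ring
    have h2 : ∏ k ∈ Finset.range m, (r + (((m + 1 : ℕ) + 1 : K) * θ - ((k : K) + 1)))
        = ∏ k ∈ Finset.range m, (r + θ + (((m : K) + 1) * θ - ((k : K) + 1))) :=
      Finset.prod_congr rfl fun k _ => by push_cast; ring
    rw [h1, h2]
    push_cast
    field_simp
    ring

theorem rothe_comp_sub [CharZero K] (n : ℕ) (c : K) :
    ((rothe θ (n + 1)).comp (X + C c)).comp (X + 1) - (rothe θ (n + 1)).comp (X + C c)
      = (rothe θ n).comp (X + C (c + θ)) := by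
  refine Polynomial.funext fun r => ?_
  have := rothe_eval_succ_sub θ n (r + c)
  simp only [eval_sub, eval_comp, eval_add, eval_X, eval_C, eval_one]
  rw [← add_assoc, ← this]
  congr 2
  ring

theorem rothe_coeff_zero (n : ℕ) : (rothe θ n).coeff 0 = if n = 0 then 1 else 0 := by
  cases n <;> simp [rothe]

theorem eq_zero_of_eval_add_one [CharZero K] {p : K[X]} (h : ∀ r, p.eval (r + 1) = p.eval r)
    (h0 : p.eval 0 = 0) : p = 0 := by
  have hn : ∀ n : ℕ, p.eval (n : K) = 0 := by
    intro n
    induction n with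
    | zero => simpa using h0
    | succ n ih => rw [Nat.cast_succ, h, ih]
  refine Polynomial.eq_zero_of_infinite_isRoot p ?_
  refine (Set.infinite_range_of_injective (Nat.cast_injective (R := K))).mono ?_
  rintro _ ⟨n, rfl⟩
  exact hn n

/-- The Rothe–Hagen identity. -/
theorem sum_rothe_eval_mul [CharZero K] (n : ℕ) (r s : K) :
    ∑ p ∈ Finset.HasAntidiagonal.antidiagonal n, (rothe θ p.1).eval r * (rothe θ p.2).eval s
      = (rothe θ n).eval (r + s) := by
  induction n generalizing r s with
  | zero => simp [rothe]
  | succ n ih =>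
    -- For fixed s the difference of the two sides is a polynomial in r. It is 1-periodic, by the
    -- induction hypothesis at r + θ, and vanishes at r = 0; hence it is zero.
    let P : K[X] := ∑ p ∈ Finset.HasAntidiagonal.antidiagonal (n + 1), rothe θ p.1 * C ((rothe θ p.2).eval s)
      - (rothe θ (n + 1)).comp (X + C s)
    have hP : ∀ r, P.eval r = ∑ p ∈ Finset.HasAntidiagonal.antidiagonal (n + 1),
        (rothe θ p.1).eval r * (rothe θ p.2).eval s - (rothe θ (n + 1)).eval (r + s) := by
      intro r; simp [P, eval_finsetSum]
    have h0 : P = 0 := by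
      refine eq_zero_of_eval_add_one (fun r => ?_) ?_
      · rw [← sub_eq_zero, hP, hP, Finset.Nat.sum_antidiagonal_succ,
          Finset.Nat.sum_antidiagonal_succ]
        have h1 := ih (r + θ) s
        simp only [← rothe_eval_succ_sub, sub_mul, Finset.sum_sub_distrib] at h1
        have h2 := rothe_eval_succ_sub θ n (r + s)
        rw [show r + θ + s = r + s + θ by ring, ← h2] at h1
        rw [show r + 1 + s = r + s + 1 by ring]
        simp only [rothe, eval_one] at h1 ⊢
        linear_combination h1
      · rw [hP, Finset.Nat.sum_antidiagonal_succ]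
        simp [← Polynomial.coeff_zero_eq_eval_zero, rothe_coeff_zero]
    have := hP r
    rw [h0, eval_zero] at this
    linear_combination -this

/-- This is d/dr y^r = y^r log y, obtained by differentiating the convolution identity in one
argument at 0. The linear coefficients of the Rothe polynomials are those of φ = log y. -/
theorem derivative_rothe [CharZero K] (n : ℕ) :
    derivative (rothe θ n)
      = ∑ p ∈ Finset.HasAntidiagonal.antidiagonal n, rothe θ p.1 * C ((rothe θ p.2).coeff 1) := by
  refine Polynomial.funext fun r => ?_
  have h : ∑ p ∈ Finset.HasAntidiagonal.antidiagonal n, C ((rothe θ p.1).eval r) * rothe θ p.2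
      = (rothe θ n).comp (X + C r) := by
    refine Polynomial.funext fun s => ?_
    simpa [eval_finsetSum, add_comm s r] using sum_rothe_eval_mul θ n r s
  have h1 := congrArg (fun p => (derivative p).eval 0) h
  simp only [derivative_comp, derivative_sum, derivative_mul, derivative_C, zero_mul, zero_add,
    derivative_add, derivative_X, add_zero, one_mul, eval_comp, eval_add, eval_X, eval_C,
    eval_finsetSum, eval_mul] at h1
  rw [← h1]
  simp only [eval_finsetSum, eval_mul, eval_C]
  refine Finset.sum_congr rfl fun p _ => ?_
  rw [← Polynomial.coeff_zero_eq_eval_zero (derivative _), coeff_derivative]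
  simp

theorem coeff_varphi (n : ℕ) : PowerSeries.coeff n (varphi θ) = (rothe θ n).coeff 1 := by
  cases n with
  | zero => simp [varphi, rothe, coeff_one]
  | succ n =>
    simp only [varphi, PowerSeries.coeff_mk, rothe, coeff_C_mul, coeff_X_mul, coeff_zero_prod]
    rw [if_neg n.succ_ne_zero, Nat.add_sub_cancel, ← Finset.Ico_add_one_right_eq_Icc,
      Finset.prod_Ico_eq_prod_range, Nat.add_sub_cancel]
    congr 1
    refine Finset.prod_congr rfl fun a _ => ?_
    simp [add_comm]

/-- Coefficient of r^k in y^r = exp(rφ); each further factor φ corresponds to one derivative in r.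
-/
theorem coeff_varphi_pow [CharZero K] (k n : ℕ) :
    PowerSeries.coeff n (varphi θ ^ k) = k.factorial * (rothe θ n).coeff k := by
  induction k generalizing n with
  | zero => simp [rothe_coeff_zero, PowerSeries.coeff_one]
  | succ k ih =>
    rw [pow_succ, PowerSeries.coeff_mul]
    have h := congrArg (fun p => coeff p k) (derivative_rothe θ n)
    simp only [coeff_derivative, finsetSum_coeff, coeff_mul_C] at h
    simp only [ih, coeff_varphi, mul_assoc, ← Finset.mul_sum, ← h, Nat.factorial_succ]
    push_cast
    ring

theorem natDegree_rothe_le (n : ℕ) : (rothe θ n).natDegree ≤ n := by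
  cases n with
  | zero => simp [rothe]
  | succ n =>
    refine (natDegree_C_mul_le _ _).trans (natDegree_mul_le.trans ?_)
    have : (∏ a ∈ Finset.range n, (X + C (((n : K) + 1) * θ - ((a : K) + 1)))).natDegree ≤ n :=
      (natDegree_prod_le _ _).trans
        ((Finset.sum_le_card_nsmul _ _ 1 fun a _ => (natDegree_X_add_C _).le).trans (by simp))
    have := natDegree_X_le (R := K)
    omega

/-! ### Stirling numbers as iterated differences -/

/-- The linear functional `r ^ k ↦ S(k, j)` on polynomials. -/
noncomputable def stirlingFunctional (K : Type*) [Field K] (j : ℕ) : K[X] →ₗ[K] K :=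
  (basisMonomials K).constr K fun k => (Nat.stirlingSecond k j : K)

theorem stirlingFunctional_X_pow (j k : ℕ) :
    stirlingFunctional K j (X ^ k) = Nat.stirlingSecond k j := by
  have h : (X ^ k : K[X]) = basisMonomials K k := by
    rw [coe_basisMonomials, X_pow_eq_monomial]
  rw [stirlingFunctional, h, Module.Basis.constr_basis]

theorem stirlingFunctional_X_mul_zero (p : K[X]) :
    stirlingFunctional K 0 (X * p) = 0 := by
  induction p using Polynomial.induction_on' with
  | add p q hp hq => simp [mul_add, hp, hq]
  | monomial n a =>
    rw [← C_mul_X_pow_eq_monomial, mul_left_comm, ← pow_succ', C_mul', map_smul,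
      stirlingFunctional_X_pow]
    simp

theorem stirlingFunctional_X_mul_succ (j : ℕ) (p : K[X]) :
    stirlingFunctional K (j + 1) (X * p)
      = (j + 1) * stirlingFunctional K (j + 1) p + stirlingFunctional K j p := by
  induction p using Polynomial.induction_on' with
  | add p q hp hq => rw [mul_add, map_add, map_add, map_add, hp, hq]; ring
  | monomial n a =>
    rw [← C_mul_X_pow_eq_monomial, mul_left_comm, ← pow_succ', C_mul', C_mul', map_smul, map_smul,
      map_smul, stirlingFunctional_X_pow, stirlingFunctional_X_pow, stirlingFunctional_X_pow,
      Nat.stirlingSecond_succ_succ]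
    simp only [smul_eq_mul]
    push_cast
    ring

/-- Since j! S(k,j) = Δ^j r^k at r = 0, the functional is p ↦ (Δ^j p)(0)/j!, and this is one step of
the iteration. On monomials it follows from the Stirling recurrence by induction on the degree. -/
theorem stirlingFunctional_comp_sub (j : ℕ) (p : K[X]) :
    stirlingFunctional K j (p.comp (X + 1) - p) = (j + 1) * stirlingFunctional K (j + 1) p := by
  induction p using Polynomial.induction_on' generalizing j with
  | add p q hp hq =>
    rw [add_comp, add_sub_add_comm, map_add, hp, hq, map_add]; ring
  | monomial n a =>
    induction n generalizing j with
    | zero =>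
      have h := stirlingFunctional_X_pow (K := K) (j + 1) 0
      rw [pow_zero] at h
      simp only [monomial_zero_left, C_comp, sub_self, map_zero]
      rw [← mul_one (C a), C_mul', map_smul, h]
      simp
    | succ n ih =>
      have e1 : monomial (n + 1) a = X * monomial n a := by rw [X_mul_monomial]
      have e2 : (X * monomial n a).comp (X + 1) - X * monomial n a
          = X * ((monomial n a).comp (X + 1) - monomial n a)
            + ((monomial n a).comp (X + 1) - monomial n a) + monomial n a := by
        rw [mul_comp, X_comp]; ring
      rw [e1, e2, map_add, map_add, stirlingFunctional_X_mul_succ]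
      cases j with
      | zero => rw [stirlingFunctional_X_mul_zero, ih]; push_cast; ring
      | succ j =>
        rw [stirlingFunctional_X_mul_succ, ih, ih]
        push_cast
        ring

theorem stirlingFunctional_zero (p : K[X]) : stirlingFunctional K 0 p = p.eval 0 := by
  induction p using Polynomial.induction_on' with
  | add p q hp hq => simp [hp, hq]
  | monomial n a =>
    rw [← C_mul_X_pow_eq_monomial, C_mul', map_smul, stirlingFunctional_X_pow]
    cases n <;> simp

/-- Each of the j differences lowers the Rothe index by one and shifts the argument by θ; the free
shift c lets the induction run. -/
theorem factorial_mul_stirlingFunctional_rothe_comp [CharZero K] (j n : ℕ) (c : K) :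
    (j.factorial : K) * stirlingFunctional K j ((rothe θ (n + j)).comp (X + C c))
      = (rothe θ n).eval (c + j * θ) := by
  induction j generalizing c with
  | zero => simp [stirlingFunctional_zero]
  | succ j ih =>
    rw [Nat.factorial_succ, Nat.cast_mul, mul_comm ((j + 1 : ℕ) : K), mul_assoc, Nat.cast_succ,
      ← stirlingFunctional_comp_sub, ← add_assoc, rothe_comp_sub, ih]
    congr 1
    ring

theorem factorial_mul_stirlingFunctional_rothe [CharZero K] (j n : ℕ) :
    (j.factorial : K) * stirlingFunctional K j (rothe θ (n + j)) = (rothe θ n).eval (j * θ) := by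
  simpa using factorial_mul_stirlingFunctional_rothe_comp θ j n 0

theorem stirlingFunctional_eq_sum (j n : ℕ) (p : K[X]) (hp : p.natDegree ≤ n) :
    stirlingFunctional K j p
      = ∑ k ∈ Finset.range (n + 1), p.coeff k * Nat.stirlingSecond k j := by
  conv_lhs => rw [p.as_sum_range' (n + 1) (by omega)]
  rw [map_sum]
  refine Finset.sum_congr rfl fun k _ => ?_
  rw [← C_mul_X_pow_eq_monomial, C_mul', map_smul, stirlingFunctional_X_pow, smul_eq_mul]

theorem cast_choose_mul_factorial (m i : ℕ) :
    (m.choose i : K) * i.factorial = ∏ a ∈ Finset.range i, ((m : K) - a) := by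
  rw [← descPochhammer_eval_eq_prod_range, descPochhammer_eval_eq_descFactorial,
    Nat.descFactorial_eq_factorial_mul_choose]
  push_cast
  ring

/-- At r = j/N one has r + iθ = (i + j)/N = Lq, so for i ≥ 1 the product is the falling factorial of
Lq without its first factor Lq; the prefactor L supplies it up to 1/q. -/
theorem rothe_eval_div [CharZero K] (N L q i j : ℕ) (hN : N ≠ 0) (hL : L ≠ 0) (hq : q ≠ 0) (hj : j ≠ 0)
    (hij : i + j = N * L * q) :
    (N * L : K) * ((rothe (1 / (N : K)) i).eval (j * (1 / (N : K))) / j)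
      = (q : K)⁻¹ * (L * q).choose i := by
  have hN' : (N : K) ≠ 0 := by exact_mod_cast hN
  have hL' : (L : K) ≠ 0 := by exact_mod_cast hL
  have hq' : (q : K) ≠ 0 := by exact_mod_cast hq
  have hj' : (j : K) ≠ 0 := by exact_mod_cast hj
  have hc : (i : K) + j = N * L * q := by exact_mod_cast hij
  have hi' : (i.factorial : K) ≠ 0 := by exact_mod_cast i.factorial_ne_zero
  cases i with
  | zero =>
    rw [Nat.cast_zero, zero_add] at hc
    simp only [rothe, eval_one, Nat.choose_zero_right, hc]
    field_simp
    simp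
  | succ i =>
    have h := cast_choose_mul_factorial (K := K) (L * q) (i + 1)
    rw [Finset.prod_range_succ'] at h
    have h1 : ∏ a ∈ Finset.range i,
        ((j : K) * (1 / (N : K)) + (((i : K) + 1) * (1 / (N : K)) - ((a : K) + 1)))
        = ∏ a ∈ Finset.range i, (((L * q : ℕ) : K) - ((a + 1 : ℕ) : K)) := by
      refine Finset.prod_congr rfl fun a _ => ?_
      push_cast at hc ⊢
      rw [show (L : K) * q = (i + 1 + j) / N by rw [hc]; field_simp]
      ring
    simp only [rothe, eval_mul, eval_C, eval_X, eval_prod, eval_add]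
    rw [h1]
    rw [← eq_div_iff hi'] at h
    rw [h]
    push_cast
    field_simp
    simp [mul_comm]

end Rothe

end QMZV

namespace QMZV

open Finset.HasAntidiagonal (antidiagonal)

/-! ### Harmonic multiplication by 𝔷 and the Euler derivation -/

section Harmonic

variable {K : Type*} [Field K]

theorem toH1_letterZ (u : Letter) : toH1 (letterZ K u) = FreeAlgebra.ι (Coeff K) u := by
  simp [toH1, letterZ]

theorem circ_letterZ (u v : Letter) : circ (letterZ K u) (letterZ K v) = circLetter K u v := by
  simp [circ, letterZ]

theorem Z_induction {p : Z K → Prop} (h0 : p 0) (hadd : ∀ x y, p x → p y → p (x + y))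
    (hsmul : ∀ (a : Coeff K) u, p (a • letterZ K u)) (z : Z K) : p z :=
  Finsupp.induction_linear z h0 hadd fun u a => by simpa [letterZ] using hsmul a u

theorem circ_comm (x y : Z K) : circ x y = circ y x := by
  induction x using Z_induction with
  | h0 => simp
  | hadd x x' hx hx' => simp [hx, hx']
  | hsmul a u =>
    induction y using Z_induction with
    | h0 => simp
    | hadd y y' hy hy' => rw [map_add, hy, hy', map_add, LinearMap.add_apply]
    | hsmul b v =>
      simp only [map_smul, LinearMap.smul_apply, circ_letterZ]
      rw [smul_comm]
      congr 2
      cases u <;> cases v <;> simp [circLetter, add_comm]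

theorem circ_right_comm (x y z : Z K) : circ (circ x y) z = circ (circ x z) y := by
  induction x using Z_induction with
  | h0 => simp
  | hadd x x' hx hx' => simp [hx, hx']
  | hsmul a u =>
    induction y using Z_induction with
    | h0 => simp
    | hadd y y' hy hy' => simp only [map_add, LinearMap.add_apply, hy, hy']
    | hsmul b v =>
      induction z using Z_induction with
      | h0 => simp
      | hadd z z' hz hz' => simp only [map_add, LinearMap.add_apply, hz, hz']
      | hsmul c w =>
        simp only [map_smul, LinearMap.smul_apply, circ_letterZ]
        have h : circ (circLetter K u v) (letterZ K w) = circ (circLetter K u w) (letterZ K v) := by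
          cases u <;> cases v <;> cases w <;>
            simp [circLetter, circ_letterZ, add_comm, add_left_comm]
        rw [h, smul_comm c b]

theorem hstar_mul_toH1 (w : H1 K) (u z : Z K) :
    hstar (w * toH1 u) (toH1 z)
      = hstar w (toH1 z) * toH1 u + w * toH1 u * toH1 z + w * toH1 (circ u z) := by
  induction u using Z_induction with
  | h0 => simp
  | hadd u u' hu hu' =>
    simp only [map_add, mul_add, LinearMap.add_apply, hu, hu', add_mul]; abel
  | hsmul a u =>
    induction z using Z_induction with
    | h0 => simp
    | hadd z z' hz hz' => simp only [map_add, mul_add, hz, hz', add_mul]; abel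
    | hsmul b v =>
      have h := hstar_mul_letter w 1 u v
      rw [one_mul, hstar_one, hstar_one] at h
      simp only [map_smul, LinearMap.smul_apply, mul_smul_comm, smul_mul_assoc, h, smul_add]
      simp only [smul_comm b a]

/-- The only trace of commutativity and associativity of the harmonic product that is needed. By
induction on the word it reduces to the same properties of ∘. -/
theorem hstar_right_comm (w : H1 K) (y z : Z K) :
    hstar (hstar w (toH1 y)) (toH1 z) = hstar (hstar w (toH1 z)) (toH1 y) := by
  suffices h : hstar.flip (toH1 z) ∘ₗ hstar.flip (toH1 y)
      = hstar.flip (toH1 y) ∘ₗ hstar.flip (toH1 z) from LinearMap.congr_fun h w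
  refine ext_revWord fun l => ?_
  simp only [LinearMap.comp_apply, LinearMap.flip_apply]
  induction l with
  | nil =>
    have h := hstar_mul_toH1 1 y z
    have h' := hstar_mul_toH1 1 z y
    simp only [one_mul, one_hstar] at h h'
    rw [revWord, one_hstar, one_hstar, h, h', circ_comm y z]
    abel
  | cons u l ih =>
    rw [revWord, ← toH1_letterZ]
    generalize revWord K l = w at ih ⊢
    simp only [hstar_mul_toH1, map_add, LinearMap.add_apply, add_mul, ih,
      circ_comm y z, circ_right_comm _ y z]
    abel

theorem sum_antidiagonal_left_comm {M : Type*} [AddCommMonoid M] (F : ℕ → ℕ → ℕ → M) (n : ℕ) :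
    ∑ p ∈ antidiagonal n, ∑ q ∈ antidiagonal p.1, F q.1 q.2 p.2
      = ∑ p ∈ antidiagonal n, ∑ q ∈ antidiagonal p.1, F q.1 p.2 q.2 := by
  rw [Finset.sum_sigma', Finset.sum_sigma']
  let s : (Σ _ : ℕ × ℕ, ℕ × ℕ) → (Σ _ : ℕ × ℕ, ℕ × ℕ) := fun x =>
    ⟨(x.2.1 + x.1.2, x.2.2), (x.2.1, x.1.2)⟩
  refine Finset.sum_nbij' s s ?_ ?_ ?_ ?_ ?_
  all_goals
    rintro ⟨⟨i, j⟩, ⟨k, l⟩⟩ h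
    simp only [Finset.mem_sigma, Finset.HasAntidiagonal.mem_antidiagonal] at h
  · simp only [s, Finset.mem_sigma, Finset.HasAntidiagonal.mem_antidiagonal, and_true]; omega
  · simp only [s, Finset.mem_sigma, Finset.HasAntidiagonal.mem_antidiagonal, and_true]; omega
  · simp [s, h.2]
  · simp [s, h.2]
  · rfl

/-- The derivation `X d/dX`. -/
noncomputable def eulerDeriv {R : Type*} [Semiring R] (f : PowerSeries R) : PowerSeries R :=
  PowerSeries.mk fun n => n • PowerSeries.coeff n f

theorem coeff_eulerDeriv {R : Type*} [Semiring R] (f : PowerSeries R) (n : ℕ) :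
    PowerSeries.coeff n (eulerDeriv f) = n • PowerSeries.coeff n f :=
  PowerSeries.coeff_mk _ _

theorem coeff_starSeries (f h : PowerSeries (H1 K)) (n : ℕ) :
    PowerSeries.coeff n (starSeries f h)
      = ∑ p ∈ antidiagonal n, hstar (PowerSeries.coeff p.1 f) (PowerSeries.coeff p.2 h) :=
  PowerSeries.coeff_mk _ _

theorem one_starSeries (f : PowerSeries (H1 K)) : starSeries 1 f = f := by
  ext1 n
  rw [coeff_starSeries, Finset.sum_eq_single (0, n)]
  · simp [one_hstar]
  · rintro ⟨i, j⟩ hp hne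
    rw [Finset.HasAntidiagonal.mem_antidiagonal] at hp
    rw [PowerSeries.coeff_one, if_neg, map_zero, LinearMap.zero_apply]
    rintro rfl
    simp_all
  · simp

theorem nsmul_starSeries (m : ℕ) (f h : PowerSeries (H1 K)) :
    starSeries (m • f) h = m • starSeries f h := by
  ext1 n
  simp only [coeff_starSeries, map_nsmul, LinearMap.smul_apply, Finset.smul_sum]

theorem eulerDeriv_starSeries (f h : PowerSeries (H1 K)) :
    eulerDeriv (starSeries f h) = starSeries (eulerDeriv f) h + starSeries f (eulerDeriv h) := by
  ext1 n
  simp only [coeff_eulerDeriv, coeff_starSeries, map_add, Finset.smul_sum, map_nsmul,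
    LinearMap.smul_apply, ← Finset.sum_add_distrib]
  refine Finset.sum_congr rfl fun p hp => ?_
  rw [← add_smul, Finset.HasAntidiagonal.mem_antidiagonal.1 hp]

theorem starSeries_right_comm (a : PowerSeries (H1 K)) {b c : PowerSeries (H1 K)}
    (hb : ∀ n, PowerSeries.coeff n b ∈ LinearMap.range (toH1 (K := K)))
    (hc : ∀ n, PowerSeries.coeff n c ∈ LinearMap.range (toH1 (K := K))) :
    starSeries (starSeries a b) c = starSeries (starSeries a c) b := by
  ext1 n
  simp only [coeff_starSeries, map_sum, LinearMap.sum_apply]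
  rw [sum_antidiagonal_left_comm fun i j k => hstar (hstar (PowerSeries.coeff i a)
    (PowerSeries.coeff j b)) (PowerSeries.coeff k c)]
  refine Finset.sum_congr rfl fun p _ => Finset.sum_congr rfl fun q _ => ?_
  obtain ⟨y, hy⟩ := hb p.2
  obtain ⟨z, hz⟩ := hc q.2
  rw [← hy, ← hz, hstar_right_comm]

/-- Because `f` and its derivative have coefficients in 𝔷, the differentiated factor can be moved to
the far right. -/
theorem eulerDeriv_starPow {f : PowerSeries (H1 K)}
    (hf : ∀ n, PowerSeries.coeff n f ∈ LinearMap.range (toH1 (K := K))) (m : ℕ) :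
    eulerDeriv (starPow f (m + 1)) = (m + 1) • starSeries (starPow f m) (eulerDeriv f) := by
  have hf' : ∀ n, PowerSeries.coeff n (eulerDeriv f) ∈ LinearMap.range (toH1 (K := K)) := by
    intro n
    rw [coeff_eulerDeriv]
    exact nsmul_mem (hf n) n
  induction m with
  | zero => simp [starPow, one_starSeries]
  | succ m ih =>
    rw [starPow, eulerDeriv_starSeries, ih, nsmul_starSeries, starSeries_right_comm _ hf' hf,
      succ_nsmul _ (m + 1), starPow]

theorem coeff_starPow_of_lt {f : PowerSeries (H1 K)} (h0 : PowerSeries.coeff 0 f = 0)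
    {m n : ℕ} (h : n < m) : PowerSeries.coeff n (starPow f m) = 0 := by
  induction m generalizing n with
  | zero => omega
  | succ m ih =>
    rw [starPow, coeff_starSeries]
    refine Finset.sum_eq_zero fun p hp => ?_
    rw [Finset.HasAntidiagonal.mem_antidiagonal] at hp
    rcases Nat.eq_zero_or_pos p.2 with h2 | h2
    · rw [h2, h0, map_zero]
    · rw [ih (by omega), map_zero, LinearMap.zero_apply]

theorem coeff_expStar {f : PowerSeries (H1 K)} (h0 : PowerSeries.coeff 0 f = 0)
    {m n : ℕ} (h : n < m) : PowerSeries.coeff n (expStar f)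
      = ∑ k ∈ Finset.range m, (k.factorial : K)⁻¹ • PowerSeries.coeff n (starPow f k) := by
  rw [expStar, formalSum, PowerSeries.coeff_mk]
  refine finsum_eq_sum_of_support_subset _ fun k hk => ?_
  by_contra hm
  refine hk ?_
  simp only [Finset.coe_range, Set.mem_Iio, not_lt] at hm
  change (k.factorial : K)⁻¹ • PowerSeries.coeff n (starPow f k) = 0
  rw [coeff_starPow_of_lt h0 (by omega), smul_zero]

theorem eulerDeriv_expStar [CharZero K] {f : PowerSeries (H1 K)}
    (hf : ∀ n, PowerSeries.coeff n f ∈ LinearMap.range (toH1 (K := K)))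
    (h0 : PowerSeries.coeff 0 f = 0) :
    eulerDeriv (expStar f) = starSeries (expStar f) (eulerDeriv f) := by
  ext1 n
  rw [coeff_eulerDeriv, coeff_expStar h0 n.lt_succ_self, Finset.sum_range_succ', smul_add,
    Finset.smul_sum]
  have hz : n • ((Nat.factorial 0 : K)⁻¹ • PowerSeries.coeff n (starPow f 0)) = 0 := by
    cases n <;> simp [starPow, PowerSeries.coeff_one]
  have hs : ∀ k ∈ Finset.range n,
      n • (((k + 1).factorial : K)⁻¹ • PowerSeries.coeff n (starPow f (k + 1)))
        = (k.factorial : K)⁻¹ • PowerSeries.coeff n (starSeries (starPow f k) (eulerDeriv f)) := by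
    intro k _
    rw [smul_comm, ← coeff_eulerDeriv, eulerDeriv_starPow hf, map_nsmul,
      ← Nat.cast_smul_eq_nsmul K, smul_smul, Nat.factorial_succ]
    congr 1
    have h1 : ((k + 1 : ℕ) : K) ≠ 0 := by exact_mod_cast k.succ_ne_zero
    rw [Nat.cast_mul, mul_inv_rev, mul_assoc, inv_mul_cancel₀ h1, mul_one]
  rw [hz, add_zero, Finset.sum_congr rfl hs, coeff_starSeries]
  simp only [coeff_starSeries, Finset.smul_sum]
  rw [Finset.sum_comm]
  refine Finset.sum_congr rfl fun p hp => ?_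
  rw [Finset.HasAntidiagonal.mem_antidiagonal] at hp
  -- The derivative of `f` has no constant term, so only p.1 < n contributes, where the exponential
  -- truncated to `range n` is already exact.
  rcases Nat.eq_zero_or_pos p.2 with h2 | h2
  · simp [h2, coeff_eulerDeriv]
  · rw [coeff_expStar h0 (show p.1 < n by omega), map_sum, LinearMap.sum_apply]
    refine Finset.sum_congr rfl fun k _ => ?_
    rw [LinearMap.map_smul_of_tower, LinearMap.smul_apply]

/-- As `h` has no constant term, n times the n-th coefficient is determined by the lower
coefficients. -/
theorem eq_of_eulerDeriv_eq_starSeries [CharZero K] {E F h : PowerSeries (H1 K)}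
    (hh : PowerSeries.coeff 0 h = 0) (hE : eulerDeriv E = starSeries E h)
    (hF : eulerDeriv F = starSeries F h)
    (h0 : PowerSeries.coeff 0 E = PowerSeries.coeff 0 F) : E = F := by
  ext1 n
  induction n using Nat.strong_induction_on with
  | _ n ih =>
    rcases Nat.eq_zero_or_pos n with rfl | hn
    · exact h0
    · have h1 := congrArg (PowerSeries.coeff n) hE
      have h2 := congrArg (PowerSeries.coeff n) hF
      rw [coeff_eulerDeriv, coeff_starSeries] at h1 h2
      have h3 : n • PowerSeries.coeff n E = n • PowerSeries.coeff n F := by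
        rw [h1, h2]
        refine Finset.sum_congr rfl fun p hp => ?_
        rw [Finset.HasAntidiagonal.mem_antidiagonal] at hp
        rcases Nat.eq_zero_or_pos p.2 with h4 | h4
        · rw [h4, hh, map_zero, map_zero]
        · rw [ih p.1 (by omega)]
      rw [← Nat.cast_smul_eq_nsmul K, ← Nat.cast_smul_eq_nsmul K] at h3
      have hn' : (n : K) ≠ 0 := by exact_mod_cast hn.ne'
      simpa [smul_smul, inv_mul_cancel₀ hn'] using congrArg (fun x => (n : K)⁻¹ • x) h3

theorem coeff_zero_expStar {f : PowerSeries (H1 K)} (h0 : PowerSeries.coeff 0 f = 0) :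
    PowerSeries.coeff 0 (expStar f) = 1 := by
  rw [coeff_expStar h0 Nat.zero_lt_one]
  simp [starPow]

/-! ### Harmonic products of concatenation powers -/

/-- The sum of all words obtained by inserting `y` into `z ^ m`. -/
noncomputable def insertSum (z y : Z K) (m : ℕ) : H1 K :=
  ∑ p ∈ antidiagonal m, toH1 z ^ p.1 * toH1 y * toH1 z ^ p.2

theorem insertSum_succ (z y : Z K) (m : ℕ) :
    insertSum z y (m + 1) = insertSum z y m * toH1 z + toH1 z ^ (m + 1) * toH1 y := by
  rw [insertSum, Finset.Nat.sum_antidiagonal_succ', insertSum, Finset.sum_mul, add_comm]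
  simp [pow_succ, mul_assoc]

/-- Quasi-shuffle: `y` is either inserted between the factors `z` or merged with one of them by ∘.
-/
theorem hstar_pow_succ (z y : Z K) (m : ℕ) :
    hstar (toH1 z ^ (m + 1)) (toH1 y) = insertSum z y (m + 1) + insertSum z (circ z y) m := by
  induction m with
  | zero =>
    rw [pow_succ, hstar_mul_toH1, insertSum_succ]
    simp [insertSum, one_hstar, add_assoc]
  | succ m ih =>
    rw [pow_succ, hstar_mul_toH1, ih, insertSum_succ _ _ (m + 1), insertSum_succ _ (circ z y) m,
      add_mul, pow_succ _ (m + 1)]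
    abel

theorem insertSum_self (z : Z K) (m : ℕ) : insertSum z z m = (m + 1) • toH1 z ^ (m + 1) := by
  rw [insertSum, Finset.sum_congr rfl (g := fun _ => toH1 z ^ (m + 1))]
  · simp
  · intro p hp
    rw [Finset.HasAntidiagonal.mem_antidiagonal] at hp
    rw [← pow_succ, ← pow_add, add_right_comm, hp]

theorem circ_circPow_succ (z : Z K) (j : ℕ) : circ z (circPow z (j + 1)) = circPow z (j + 2) := by
  rw [circ_comm]; rfl

/-- The merging part of each term cancels the insertion part of its neighbour; what survives is `z`
inserted into `z ^ r`. -/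
theorem sum_hstar_pow_circPow (z : Z K) (r : ℕ) :
    ∑ p ∈ antidiagonal r, (-1 : Coeff K) ^ p.1 • hstar (toH1 z ^ p.1) (toH1 (circPow z (p.2 + 1)))
      = (-1 : Coeff K) ^ r • (r + 1) • toH1 z ^ (r + 1) := by
  cases r with
  | zero => simp [one_hstar, circPow]
  | succ r =>
    have h := (Finset.Nat.sum_antidiagonal_succ (n := r) (f := fun p : ℕ × ℕ =>
      (-1 : Coeff K) ^ p.1 • insertSum z (circPow z (p.2 + 1)) p.1)).symm.trans
      Finset.Nat.sum_antidiagonal_succ'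
    rw [Finset.Nat.sum_antidiagonal_succ]
    simp only [hstar_pow_succ, circ_circPow_succ, smul_add, Finset.sum_add_distrib, pow_zero,
      one_smul, one_hstar] at h ⊢
    have h0 : insertSum z (circPow z (r + 1 + 1)) 0 = toH1 (circPow z (r + 1 + 1)) := by
      simp [insertSum]
    rw [h0] at h
    rw [← add_assoc, h, circPow, insertSum_self]
    simp only [pow_succ _ _, mul_neg, mul_one, neg_smul, Finset.sum_neg_distrib]
    abel

end Harmonic

end QMZV

namespace QMZV

open Finset.HasAntidiagonal (antidiagonal)

/-! ### The geometric series as a harmonic exponential -/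

section Exponential

variable {K : Type*} [Field K]

theorem sum_antidiagonal_mul {A : Type*} [AddCommMonoid A] {M : ℕ} (hM : 0 < M) (q : ℕ)
    (F : ℕ × ℕ → A) (hF : ∀ p, ¬ M ∣ p.1 → F p = 0) :
    ∑ p ∈ antidiagonal (M * q), F p = ∑ p ∈ antidiagonal q, F (M * p.1, M * p.2) := by
  symm
  refine Finset.sum_of_injOn (fun p => (M * p.1, M * p.2)) ?_ ?_ ?_ fun _ _ => rfl
  · rintro ⟨a, b⟩ _ ⟨c, d⟩ _ h
    simpa [hM.ne'] using h
  · intro p hp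
    simp only [Finset.mem_coe, Finset.HasAntidiagonal.mem_antidiagonal] at hp ⊢
    rw [← mul_add, hp]
  · rintro ⟨a, b⟩ hp hne
    refine hF _ fun hd => hne ?_
    rw [Finset.HasAntidiagonal.mem_antidiagonal] at hp
    obtain ⟨c, hc⟩ := hd
    obtain ⟨d, hd⟩ := (Nat.dvd_add_right (Dvd.intro c hc.symm)).1 (hp ▸ Dvd.intro q rfl)
    simp only at hp hc hd
    refine ⟨(c, d), ?_, by simp [hc, hd]⟩
    rw [Finset.mem_coe, Finset.HasAntidiagonal.mem_antidiagonal]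
    refine Nat.eq_of_mul_eq_mul_left hM ?_
    rw [mul_add, ← hc, ← hd, hp]

/-- The geometric series `∑ a ^ q X ^ (M q)`. -/
noncomputable def geomSeries {R : Type*} [Ring R] (M : ℕ) (a : R) : PowerSeries R :=
  PowerSeries.mk fun n => if M ∣ n then a ^ (n / M) else 0

theorem geomSeries_eq_invOfUnit {R : Type*} [Ring R] {M : ℕ} (hM : 0 < M) (a : R) :
    PowerSeries.invOfUnit (1 + PowerSeries.C a * PowerSeries.X ^ M) 1 = geomSeries M (-a) := by
  have h1 : geomSeries M (-a) * (1 + PowerSeries.C a * PowerSeries.X ^ M) = 1 := by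
    ext n
    rw [mul_add, mul_one, ← mul_assoc, map_add, PowerSeries.coeff_mul_X_pow',
      PowerSeries.coeff_mul_C, PowerSeries.coeff_one, geomSeries, PowerSeries.coeff_mk,
      PowerSeries.coeff_mk]
    rcases Nat.lt_or_ge n M with hn | hn
    · rw [if_neg hn.not_ge, add_zero]
      rcases Nat.eq_zero_or_pos n with rfl | hn0
      · simp
      · rw [if_neg (Nat.not_dvd_of_pos_of_lt hn0 hn), if_neg hn0.ne']
    · obtain ⟨m, rfl⟩ := Nat.exists_eq_add_of_le hn
      have hne : M + m ≠ 0 := by omega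
      simp only [hn, if_true, Nat.add_sub_cancel_left, Nat.dvd_add_right (dvd_refl M), hne, if_false]
      split_ifs with h
      · rw [Nat.add_div_left _ hM, pow_succ]; simp
      · simp
  have h2 : (1 + PowerSeries.C a * PowerSeries.X ^ M)
      * PowerSeries.invOfUnit (1 + PowerSeries.C a * PowerSeries.X ^ M) 1 = 1 :=
    PowerSeries.mul_invOfUnit _ _ (by simp [hM.ne'])
  exact (left_inv_eq_right_inv h1 h2).symm

/-- The series `-∑_{q ≥ 1} z^{∘ q} X ^ (M q) / q`. -/
noncomputable def circLog (M : ℕ) (z : Z K) : PowerSeries (H1 K) :=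
  PowerSeries.mk fun n =>
    if M ∣ n then toH1 (-(((n / M : ℕ) : K)⁻¹ • circPow z (n / M))) else 0

theorem coeff_eulerDeriv_circLog [CharZero K] {M : ℕ} (hM : 0 < M) (z : Z K) (q : ℕ) :
    PowerSeries.coeff (M * q) (eulerDeriv (circLog M z)) = -(M • toH1 (circPow z q)) := by
  rw [coeff_eulerDeriv, circLog, PowerSeries.coeff_mk, if_pos (Dvd.intro q rfl),
    Nat.mul_div_cancel_left q hM, map_neg, smul_neg, mul_smul]
  rcases Nat.eq_zero_or_pos q with rfl | hq
  · simp [circPow]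
  · have hq' : (q : K) ≠ 0 := by exact_mod_cast hq.ne'
    rw [← map_nsmul, ← Nat.cast_smul_eq_nsmul K q, smul_smul, mul_inv_cancel₀ hq', one_smul]

theorem eulerDeriv_geomSeries [CharZero K] {M : ℕ} (hM : 0 < M) (z : Z K) :
    eulerDeriv (geomSeries M (-toH1 z))
      = starSeries (geomSeries M (-toH1 z)) (eulerDeriv (circLog M z)) := by
  ext1 n
  by_cases hn : M ∣ n
  · obtain ⟨q, rfl⟩ := hn
    rw [coeff_starSeries, sum_antidiagonal_mul hM]
    · rw [coeff_eulerDeriv]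
      simp only [coeff_eulerDeriv_circLog hM, geomSeries, PowerSeries.coeff_mk, Nat.dvd_mul_right,
        if_true, Nat.mul_div_cancel_left _ hM]
      cases q with
      | zero => simp [circPow]
      | succ r =>
        rw [Finset.Nat.sum_antidiagonal_succ']
        have h := sum_hstar_pow_circPow z r
        have hp : ∀ i, (-toH1 z) ^ i = (-1 : Coeff K) ^ i • toH1 z ^ i := fun i => by
          rw [← smul_pow, neg_one_smul]
        -- The term containing `circPow z 0` vanishes thanks to the default value 0.
        simp only [hp, map_neg, map_nsmul, map_smul, LinearMap.smul_apply, circPow, map_zero,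
          smul_zero, neg_zero, zero_add, Finset.sum_neg_distrib, ← Finset.smul_sum, h]
        have hs : (-1 : Coeff K) ^ (r + 1) • toH1 z ^ (r + 1)
            = -((-1 : Coeff K) ^ r • toH1 z ^ (r + 1)) := by
          rw [pow_succ, mul_neg_one]
          exact neg_smul ((-1 : Coeff K) ^ r) (toH1 z ^ (r + 1))
        rw [mul_smul, hs, smul_neg, smul_neg, smul_comm (r + 1) ((-1 : Coeff K) ^ r)]
    · intro p hp
      rw [geomSeries, PowerSeries.coeff_mk, if_neg hp, map_zero, LinearMap.zero_apply]
  · rw [coeff_eulerDeriv, coeff_starSeries, geomSeries, PowerSeries.coeff_mk, if_neg hn, smul_zero]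
    refine (Finset.sum_eq_zero fun p hp => ?_).symm
    rw [Finset.HasAntidiagonal.mem_antidiagonal] at hp
    rw [PowerSeries.coeff_mk]
    split_ifs with h1
    · have h2 : ¬ M ∣ p.2 := fun h2 => hn (hp ▸ dvd_add h1 h2)
      rw [coeff_eulerDeriv, circLog, PowerSeries.coeff_mk, if_neg h2, smul_zero, map_zero]
    · rw [map_zero, LinearMap.zero_apply]

theorem expStar_circLog [CharZero K] {M : ℕ} (hM : 0 < M) (z : Z K) :
    expStar (circLog M z) = geomSeries M (-toH1 z) := by
  have h0 : PowerSeries.coeff 0 (circLog M z) = 0 := by simp [circLog, circPow]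
  have hr : ∀ n, PowerSeries.coeff n (circLog M z) ∈ LinearMap.range (toH1 (K := K)) := by
    intro n
    rw [circLog, PowerSeries.coeff_mk]
    split_ifs
    · exact LinearMap.mem_range_self _ _
    · exact zero_mem _
  refine eq_of_eulerDeriv_eq_starSeries ?_ (eulerDeriv_expStar hr h0) (eulerDeriv_geomSeries hM z)
    ?_
  · rw [coeff_eulerDeriv, zero_smul]
  · rw [coeff_zero_expStar h0]
    simp [geomSeries]

end Exponential

/-! ### Polynomials as a model of (𝔷, ∘) -/

section Embedding

variable {K : Type*} [Field K]

open Polynomial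

/-- The `K`-linear map sending `s ^ j` to `ħ^{-j} g_j`. -/
noncomputable def polyToZ (K : Type*) [Field K] : K[X] →ₗ[K] Z K :=
  (basisMonomials K).constr K fun j => hbarPow K (-(j : ℤ)) • g K j

theorem polyToZ_X_pow (j : ℕ) : polyToZ K (X ^ j) = hbarPow K (-(j : ℤ)) • g K j := by
  have h : (X ^ j : K[X]) = basisMonomials K j := by
    rw [coe_basisMonomials, X_pow_eq_monomial]
  rw [polyToZ, h, Module.Basis.constr_basis]

theorem polyToZ_smul_X_pow (a : K) (j : ℕ) : polyToZ K (a • X ^ j)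
    = (algebraMap K (Coeff K) a * hbarPow K (-(j : ℤ))) • g K j := by
  rw [map_smul, polyToZ_X_pow, ← algebraMap_smul (Coeff K) a, smul_smul]

theorem hbarPow_mul (m n : ℤ) : hbarPow K m * hbarPow K n = hbarPow K (m + n) :=
  (LaurentPolynomial.T_add m n).symm

theorem circ_g (i j : ℕ) : circ (g K (i + 1)) (g K (j + 1)) = g K (i + 1 + (j + 1)) := by
  change circ (letterZ K _) (letterZ K _) = letterZ K _
  rw [circ_letterZ]
  simp only [circLetter]
  congr 2

/-- On monomials this is g_i ∘ g_j = g_{i+j}. The factors `X` exclude constant terms, which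
`polyToZ` kills because `g K 0 = 0`. -/
theorem polyToZ_X_mul_mul (p r : K[X]) :
    polyToZ K (X * p * (X * r)) = circ (polyToZ K (X * p)) (polyToZ K (X * r)) := by
  induction p using Polynomial.induction_on' with
  | add p p' hp hp' => simp only [mul_add, add_mul, map_add, LinearMap.add_apply, hp, hp']
  | monomial i a =>
    induction r using Polynomial.induction_on' with
    | add r r' hr hr' => simp only [mul_add, map_add, hr, hr']
    | monomial j b =>
      have e1 : X * monomial i a = a • (X ^ (i + 1) : K[X]) := by
        rw [← C_mul_X_pow_eq_monomial, ← C_mul']; ring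
      have e2 : X * monomial j b = b • (X ^ (j + 1) : K[X]) := by
        rw [← C_mul_X_pow_eq_monomial, ← C_mul']; ring
      have e3 : (-((i + 1 + (j + 1) : ℕ) : ℤ)) = -((i + 1 : ℕ) : ℤ) + -((j + 1 : ℕ) : ℤ) := by
        push_cast; ring
      rw [e1, e2, smul_mul_smul_comm, ← pow_add, polyToZ_smul_X_pow, polyToZ_smul_X_pow,
        polyToZ_smul_X_pow]
      simp only [map_smul, LinearMap.smul_apply, map_mul, circ_g, smul_smul,
        e3, ← hbarPow_mul]
      congr 1
      ring

theorem circPow_polyToZ (p : K[X]) (n : ℕ) :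
    circPow (polyToZ K (X * p)) (n + 1) = polyToZ K ((X * p) ^ (n + 1)) := by
  induction n with
  | zero => simp [circPow]
  | succ n ih =>
    rw [circPow, ih, pow_succ _ (n + 1), pow_succ _ n]
    rw [show (X * p) ^ n * (X * p) = X * ((X * p) ^ n * p) by ring, polyToZ_X_mul_mul]

theorem circPow_smul (a : Coeff K) (z : Z K) (n : ℕ) :
    circPow (a • z) n = a ^ n • circPow z n := by
  rcases n with _ | n
  · simp [circPow]
  · induction n with
    | zero => simp [circPow]
    | succ n ih =>
      rw [circPow, ih, map_smul, map_smul, LinearMap.smul_apply, smul_smul, circPow,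
        pow_succ _ (n + 1), mul_comm a]

theorem smul_e (n : ℕ) : hbarPow K (-((n + 2 : ℕ) : ℤ)) • e K (n + 2)
    = polyToZ K (X * (X ^ n * (1 + X))) := by
  rw [show (X * (X ^ n * (1 + X)) : K[X]) = X ^ (n + 2) + X ^ (n + 1) by ring, map_add,
    polyToZ_X_pow, polyToZ_X_pow, e, smul_add, smul_smul, hbarPow_mul]
  congr 3

/-- ħ^{-N} e_N corresponds to s^N + s^{N-1}, which for N ≥ 2 is divisible by s, so its ∘-powers are
ordinary powers. -/
theorem circPow_smul_circPow_e (N L n : ℕ) (hN : 2 ≤ N) (hL : 1 ≤ L) :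
    circPow (hbarPow K (-((N * L : ℕ) : ℤ)) • circPow (e K N) L) (n + 1)
      = polyToZ K ((X ^ (N - 1) * (1 + X)) ^ (L * (n + 1))) := by
  obtain ⟨N, rfl⟩ := Nat.exists_eq_add_of_le' hN
  obtain ⟨L, rfl⟩ := Nat.exists_eq_add_of_le' hL
  have h : hbarPow K (-(((N + 2) * (L + 1) : ℕ) : ℤ)) = hbarPow K (-((N + 2 : ℕ) : ℤ)) ^ (L + 1) := by
    rw [hbarPow, hbarPow, LaurentPolynomial.T_pow]
    congr 1
    push_cast
    ring
  rw [h, ← circPow_smul, smul_e, circPow_polyToZ]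
  rw [show (X * (X ^ N * (1 + X)) : K[X]) ^ (L + 1)
    = X * ((X ^ N * (1 + X)) * (X * (X ^ N * (1 + X)) : K[X]) ^ L) by ring, circPow_polyToZ]
  have hq : X * (X ^ N * (1 + X) * (X * (X ^ N * (1 + X))) ^ L)
      = (X ^ (N + 1) * (1 + X) : K[X]) ^ (L + 1) := by ring
  rw [hq, ← pow_mul]
  rfl

theorem smul_phi (k : ℕ) : hbarPow K (-(k : ℤ)) • phi K k
    = polyToZ K (∑ j ∈ Finset.Icc 1 k,
        (((j - 1).factorial : K) * Nat.stirlingSecond k j) • X ^ j) := by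
  rw [phi, Finset.smul_sum, map_sum]
  refine Finset.sum_congr rfl fun j _ => ?_
  rw [map_smul, polyToZ_X_pow, ← Nat.cast_mul, Nat.cast_smul_eq_nsmul, smul_smul, mul_left_comm,
    hbarPow_mul, ← smul_smul, Nat.cast_smul_eq_nsmul]
  congr 4
  ring

end Embedding

end QMZV

namespace QMZV

/-! ### The underlying polynomial identity -/

section Polynomial

variable {K : Type*} [Field K]

open Polynomial

/-- The polynomial `∑_{j=1}^k (j-1)! S(k,j) s ^ j` corresponding to `ħ^{-k} φ_k`. -/
noncomputable def phiPoly (K : Type*) [Field K] (k : ℕ) : K[X] :=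
  ∑ j ∈ Finset.Icc 1 k, (((j - 1).factorial : K) * Nat.stirlingSecond k j) • X ^ j

theorem coeff_zero_phiPoly (k : ℕ) : (phiPoly K k).coeff 0 = 0 := by
  rw [phiPoly, finsetSum_coeff]
  refine Finset.sum_eq_zero fun j hj => ?_
  rw [Finset.mem_Icc] at hj
  rw [coeff_smul, coeff_X_pow, if_neg (by omega), smul_zero]

theorem coeff_succ_phiPoly (k j : ℕ) :
    (phiPoly K k).coeff (j + 1) = (j.factorial : K) * Nat.stirlingSecond k (j + 1) := by
  simp only [phiPoly, finsetSum_coeff, coeff_smul, coeff_X_pow, smul_eq_mul, mul_ite, mul_one,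
    mul_zero, Finset.sum_ite_eq, Finset.mem_Icc, Nat.add_sub_cancel]
  split_ifs with h
  · rfl
  · rw [Nat.stirlingSecond_eq_zero_of_lt (by omega), Nat.cast_zero, mul_zero]

/-- The factor a = m of the product is zero, and it occurs because m ≤ Nm - 1 for N ≥ 2. This is why
the exponent in the theorem has no k = 1 term. -/
theorem coeff_one_rothe_eq_zero [CharZero K] (N m : ℕ) (hN : 2 ≤ N) (hm : m ≠ 0) :
    (rothe (1 / (N : K)) (N * m)).coeff 1 = 0 := by
  have hN' : (N : K) ≠ 0 := by exact_mod_cast (show N ≠ 0 by omega)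
  have h2 : 2 * m ≤ N * m := Nat.mul_le_mul_right m hN
  rw [← coeff_varphi, varphi, PowerSeries.coeff_mk, if_neg (by omega)]
  rw [Finset.prod_eq_zero (i := m) (Finset.mem_Icc.2 (by omega)), mul_zero]
  push_cast
  field_simp
  simp

theorem coeff_X_pow_mul_one_add_X_pow (N m j : ℕ) (hN : 1 ≤ N) (hj : j ≤ N * m) :
    ((X ^ (N - 1) * (1 + X) : K[X]) ^ m).coeff j = m.choose (N * m - j) := by
  obtain ⟨N, rfl⟩ := Nat.exists_eq_add_of_le' hN
  rw [mul_pow, ← pow_mul, coeff_X_pow_mul', coeff_one_add_X_pow, Nat.add_sub_cancel]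
  rw [add_mul, one_mul] at hj ⊢
  split_ifs with h
  · rw [← Nat.choose_symm (by omega)]
    congr 2
    omega
  · rw [Nat.choose_eq_zero_of_lt (by omega), Nat.cast_zero]

theorem coeff_X_pow_mul_one_add_X_pow_of_lt (N m j : ℕ) (hN : 1 ≤ N) (hj : N * m < j) :
    ((X ^ (N - 1) * (1 + X) : K[X]) ^ m).coeff j = 0 := by
  obtain ⟨N, rfl⟩ := Nat.exists_eq_add_of_le' hN
  rw [mul_pow, ← pow_mul, coeff_X_pow_mul', coeff_one_add_X_pow, Nat.add_sub_cancel]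
  rw [add_mul, one_mul] at hj
  split_ifs with h
  · rw [Nat.choose_eq_zero_of_lt (by omega), Nat.cast_zero]
  · rfl

/-- Up to the factor NL, the coefficient of s^j on the left is (j-1)! times the Stirling functional
of the Rothe polynomial, that is, a Rothe value at j/N divided by j. `rothe_eval_div` makes it the
binomial coefficient on the right. -/
theorem sum_coeff_rothe_smul_phiPoly [CharZero K] (N L q : ℕ) (hN : 2 ≤ N) (hL : L ≠ 0)
    (hq : q ≠ 0) :
    ∑ k ∈ Finset.Icc 2 (N * L * q),
        ((N * L : K) * (rothe (1 / (N : K)) (N * L * q)).coeff k) • phiPoly K k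
      = (q : K)⁻¹ • (X ^ (N - 1) * (1 + X)) ^ (L * q) := by
  have hn : N * L * q = N * (L * q) := mul_assoc _ _ _
  have hLq : L * q ≠ 0 := Nat.mul_ne_zero hL hq
  have hn0 : N * L * q ≠ 0 := by rw [hn]; exact Nat.mul_ne_zero (by omega) hLq
  set n := N * L * q with hn_def
  have hsub : Finset.Icc 2 n ⊆ Finset.range (n + 1) := fun k hk => by
    rw [Finset.mem_Icc] at hk
    exact Finset.mem_range.2 (by omega)
  rw [Finset.sum_subset hsub]
  · ext j
    simp only [finsetSum_coeff, coeff_smul, smul_eq_mul]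
    cases j with
    | zero =>
      simp only [coeff_zero_phiPoly, mul_zero, Finset.sum_const_zero]
      rw [coeff_X_pow_mul_one_add_X_pow _ _ _ (by omega) (Nat.zero_le _),
        Nat.choose_eq_zero_of_lt, Nat.cast_zero, mul_zero]
      have := Nat.mul_le_mul_right (L * q) hN
      omega
    | succ j =>
      simp only [coeff_succ_phiPoly]
      rcases Nat.lt_or_ge n (j + 1) with hj | hj
      · rw [coeff_X_pow_mul_one_add_X_pow_of_lt _ _ _ (by omega) (by omega), mul_zero]
        refine Finset.sum_eq_zero fun k hk => ?_
        rw [Finset.mem_range] at hk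
        rw [Nat.stirlingSecond_eq_zero_of_lt (by omega), Nat.cast_zero, mul_zero, mul_zero]
      · rw [coeff_X_pow_mul_one_add_X_pow _ _ _ (by omega) (by omega), ← hn,
          ← rothe_eval_div N L q (n - (j + 1)) (j + 1) (by omega) hL hq j.succ_ne_zero (by omega),
          ← factorial_mul_stirlingFunctional_rothe, Nat.sub_add_cancel hj,
          stirlingFunctional_eq_sum _ n _ (natDegree_rothe_le _ _), Nat.factorial_succ,
          Nat.cast_mul, mul_assoc ((j + 1 : ℕ) : K),
          mul_div_cancel_left₀ _ (by exact_mod_cast j.succ_ne_zero), Finset.mul_sum,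
          Finset.mul_sum]
        refine Finset.sum_congr rfl fun k _ => ?_
        ring
  · intro k hk hk'
    rw [Finset.mem_range] at hk
    rw [Finset.mem_Icc] at hk'
    have h : (rothe (1 / (N : K)) n).coeff k = 0 := by
      obtain rfl | rfl : k = 0 ∨ k = 1 := by omega
      · rw [rothe_coeff_zero, if_neg hn0]
      · rw [hn]; exact coeff_one_rothe_eq_zero N _ hN hLq
    rw [h, mul_zero, zero_smul]

end Polynomial

/-! ### The root-of-unity sum and the conclusion -/

section Main

theorem eps_isPrimitiveRoot (n : ℕ) (hn : n ≠ 0) : IsPrimitiveRoot (eps n) n :=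
  Complex.isPrimitiveRoot_exp n hn

theorem sum_eps_pow (M n : ℕ) (hM : M ≠ 0) :
    ∑ m ∈ Finset.Icc 1 M, (eps M ^ m) ^ n = if M ∣ n then (M : ℂ) else 0 := by
  have hp := eps_isPrimitiveRoot M hM
  simp only [← pow_mul, mul_comm _ n]
  simp only [pow_mul]
  split_ifs with h
  · rw [(hp.pow_eq_one_iff_dvd n).2 h]
    simp
  · have h1 : eps M ^ n ≠ 1 := fun h1 => h ((hp.pow_eq_one_iff_dvd n).1 h1)
    have h2 : (eps M ^ n) ^ M = 1 := by rw [← pow_mul, mul_comm, pow_mul, hp.pow_eq_one, one_pow]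
    rw [← Finset.Ico_add_one_right_eq_Icc, Finset.sum_Ico_eq_sub _ (by omega),
      Finset.sum_range_succ, h2, geom_sum_eq h1, h2]
    simp

theorem coeff_mulSeries {K : Type*} [Field K] (w : H1 K) (s : PowerSeries K) (n : ℕ) :
    PowerSeries.coeff n (mulSeries w s) = PowerSeries.coeff n s • w := by
  rw [mulSeries, PowerSeries.coeff_C_mul, PowerSeries.coeff_map, ← Algebra.commutes,
    Algebra.smul_def]

theorem coeff_sum_rescale_varphi_pow (M : ℕ) (hM : M ≠ 0) (θ : ℂ) (k n : ℕ) :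
    PowerSeries.coeff n
        (∑ m ∈ Finset.Icc 1 M, (PowerSeries.rescale (eps M ^ m) (varphi θ)) ^ k)
      = (if M ∣ n then (M : ℂ) else 0) * (k.factorial * (rothe θ n).coeff k) := by
  simp only [map_sum, ← map_pow, PowerSeries.coeff_rescale, ← Finset.sum_mul]
  rw [sum_eps_pow M n hM, coeff_varphi_pow]

theorem finsum_Ici_two {A : Type*} [AddCommMonoid A] (F : ℕ → A) (n : ℕ)
    (hF : ∀ k, n < k → F k = 0) :
    ∑ᶠ k : Set.Ici (2 : ℕ), F k = ∑ k ∈ Finset.Icc 2 n, F k := by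
  rw [finsum_set_coe_eq_finsum_mem (Set.Ici 2) (f := F)]
  refine finsum_mem_eq_sum_of_inter_support_eq _ ?_
  ext k
  simp only [Set.mem_inter_iff, Set.mem_Ici, Function.mem_support, Finset.coe_Icc, Set.mem_Icc]
  constructor
  · rintro ⟨h1, h2⟩
    exact ⟨⟨h1, not_lt.1 fun h => h2 (hF k h)⟩, h2⟩
  · rintro ⟨⟨h1, _⟩, h2⟩
    exact ⟨h1, h2⟩

theorem neg_formalSum_phi_eq_circLog (N L : ℕ) (hN : 2 ≤ N) (hL : 1 ≤ L) :
    -formalSum (fun k : Set.Ici (2 : ℕ) =>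
        mulSeries
          (toH1 ((((k : ℕ).factorial : ℂ)⁻¹) • (hbarPow ℂ (-((k : ℕ) : ℤ)) • phi ℂ (k : ℕ))))
          (∑ m ∈ Finset.Icc 1 (N * L),
            (PowerSeries.rescale (eps (N * L) ^ m) (varphi (1 / (N : ℂ)))) ^ (k : ℕ)))
      = circLog (N * L) (hbarPow ℂ (-((N * L : ℕ) : ℤ)) • circPow (e ℂ N) L) := by
  have hM : N * L ≠ 0 := Nat.mul_ne_zero (by omega) (by omega)
  ext1 n
  have hterm : ∀ k : ℕ, PowerSeries.coeff n (mulSeries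
      (toH1 (((k.factorial : ℂ)⁻¹) • (hbarPow ℂ (-(k : ℤ)) • phi ℂ k)))
      (∑ m ∈ Finset.Icc 1 (N * L),
        (PowerSeries.rescale (eps (N * L) ^ m) (varphi (1 / (N : ℂ)))) ^ k))
      = toH1 (polyToZ ℂ (((if N * L ∣ n then ((N * L : ℕ) : ℂ) else 0)
          * (rothe (1 / (N : ℂ)) n).coeff k) • phiPoly ℂ k)) := by
    intro k
    have hk : (k.factorial : ℂ) ≠ 0 := by exact_mod_cast k.factorial_ne_zero
    rw [coeff_mulSeries, coeff_sum_rescale_varphi_pow _ hM, smul_phi, ← phiPoly,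
      LinearMap.map_smul_of_tower, smul_smul, map_smul, LinearMap.map_smul_of_tower]
    congr 1
    field_simp
  rw [map_neg, formalSum, PowerSeries.coeff_mk]
  simp only [hterm]
  rw [finsum_Ici_two (fun k => toH1 (polyToZ ℂ (((if N * L ∣ n then ((N * L : ℕ) : ℂ) else 0)
          * (rothe (1 / (N : ℂ)) n).coeff k) • phiPoly ℂ k))) n]
  · rw [circLog, PowerSeries.coeff_mk]
    split_ifs with h
    · obtain ⟨q, rfl⟩ := h
      rw [Nat.mul_div_cancel_left q (Nat.pos_of_ne_zero hM)]
      rcases q with _ | q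
      · simp [circPow]
      · rw [← map_sum, ← map_sum, map_neg, circPow_smul_circPow_e N L q hN hL, ← map_smul,
          ← sum_coeff_rothe_smul_phiPoly N L (q + 1) hN (by omega) q.succ_ne_zero]
        push_cast
        rfl
    · simp
  -- The degree bound on the Rothe polynomial makes the sum over k finite in each coefficient.
  · intro k hk
    rw [Polynomial.coeff_eq_zero_of_natDegree_lt ((natDegree_rothe_le _ _).trans_lt hk)]
    simp

end Main

end QMZV

theorem theorem4p2 (N L : ℕ) (hN : 2 ≤ N) (hL : 1 ≤ L) :
    PowerSeries.invOfUnit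
        (1 + PowerSeries.C (QMZV.toH1
              (QMZV.hbarPow ℂ (-((N * L : ℕ) : ℤ)) • QMZV.circPow (QMZV.e ℂ N) L))
            * PowerSeries.X ^ (N * L)) 1
      = QMZV.expStar
          (-QMZV.formalSum fun k : Set.Ici (2 : ℕ) =>
            QMZV.mulSeries
              (QMZV.toH1 ((((k : ℕ).factorial : ℂ)⁻¹) •
                (QMZV.hbarPow ℂ (-((k : ℕ) : ℤ)) • QMZV.phi ℂ (k : ℕ))))
              (∑ m ∈ Finset.Icc 1 (N * L),
                (PowerSeries.rescale (QMZV.eps (N * L) ^ m)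
                  (QMZV.varphi (1 / (N : ℂ)))) ^ (k : ℕ))) := by
  have hM : 0 < N * L := Nat.mul_pos (by omega) (by omega)
  rw [QMZV.neg_formalSum_phi_eq_circLog N L hN hL, QMZV.expStar_circLog hM,
    QMZV.geomSeries_eq_invOfUnit hM]
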